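/- **Universal property of the cotangent module.** *Setting.* Let $M$ be a topological Lusin space (a Hausdorff space that is a continuous injective image of a Polish space) with a $\sigma$-finite Borel measure $\mathfrak m$ of full support, and let $(\mathcal E,\mathcal F)$ be a symmetric, quasi-regular, strongly local Dirichlet form on $L^2(M,\mathfrak m)$ (densely defined, closed, Markovian). The extended domain $\mathcal F_e$ is the linear space of all $\mathfrak m$-a.e. classes $f$ of real measurable functions for which some $\mathcal E$-Cauchy sequence in $\mathcal F$ converges to $f$ $\mathfrak m$-a.e. Let $\boldsymbol\mu\colon\mathcal F_e\times\mathcal F_e\to\{\text{finite signed Borel measures not charging }\mathcal E\text{-polar sets}\}$ be the energy measure of $\mathcal E$: the unique symmetric bilinear map with nonnegative diagonal $\boldsymbol\mu_f:=\boldsymbol\mu_{f,f}$ such that $$2\int_M\widetilde h\,\mathrm d\boldsymbol\mu_{f,g}=\mathcal E(fh,g)+\mathcal E(gh,f)-\mathcal E(fg,h)\qquad\text{for all } f,g,h\in\mathcal F\cap L^\infty(M,\mathfrak m)$$ (where $\widetilde h$ is an $\mathcal E$-quasi-continuous version of $h$), and $\boldsymbol\mu_{f_n}[A]\to\boldsymbol\mu_f[A]$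 for all Borel sets $A$ whenever $(f_n)$ is an $\mathcal E$-Cauchy sequence in $\mathcal F$ that converges $\mathfrak m$-a.e. to $f\in\mathcal F_e$. Let $\mu$ be an $\mathcal E$-dominant Borel measure on $M$, i.e. $\mu$ is $\sigma$-finite and $\boldsymbol\mu_f\ll\mu$ for every $f\in\mathcal F$. Then $\boldsymbol\mu_{f}\ll\mu$ for all $f\in\mathcal F_e$, and $\Gamma_\mu(f,g):=\mathrm d\boldsymbol\mu_{f,g}/\mathrm d\mu\in L^1(M,\mu)$, $\Gamma_\mu(f):=\Gamma_\mu(f,f)$. *Modules.* An $L^2$-normed $L^\infty$-module (w.r.t. $\mu$) is a real Banach space $\mathcal M$ with a bilinear map $L^\infty(M,\mu)\times\mathcal M\to\mathcal M$ satisfying $(fg)v=f(gv)$ and $1v=v$, and a nonnegatively valued map $|\cdot|\colon\mathcal M\to L^2(M,\mu)$ with $|fv|=|f|\,|v|$ $\mu$-a.e. and $\|v\|_{\mathcal M}=\||v|\|_{L^2(M,\mu)}$. It is generated by $\mathcal V\subset\mathcal M$ if those $v\in\mathcal M$ are dense for which there is a countable measurable partition $(E_k)$ of $M$ such that every $1_{E_k}v$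 is a finite $L^\infty(M,\mu)$-linear combination of elements of $\mathcal V$. A module isomorphism is a bounded, $L^\infty(M,\mu)$-linear bijection whose inverse is bounded and $L^\infty(M,\mu)$-linear. *Cotangent module.* $L^2(T^*M)$ is the completion, with respect to the norm $\|[f_i,A_i]\|^2=\sum_i\boldsymbol\mu_{f_i}[A_i]$, of the space of sequences $(f_i,A_i)_{i\in\mathbb N}$, where $(A_i)$ is a Borel partition of $M$, $f_i\in\mathcal F_e$ and $\sum_i\boldsymbol\mu_{f_i}[A_i]<\infty$, modulo the relation $(f_i,A_i)\sim(g_j,B_j)$ iff $\boldsymbol\mu_{f_i-g_j}[A_i\cap B_j]=0$ for all $i,j$; the operations are $[f_i,A_i]+[g_j,B_j]=[f_i+g_j,A_i\cap B_j]$ and $\lambda[f_i,A_i]=[\lambda f_i,A_i]$. A simple function $h=\sum_j h_j1_{B_j}$ acts by $h[f_i,A_i]=[h_jf_i,A_i\cap B_j]$, and this action extends continuously to an action of $L^\infty(M,\mu)$ on $L^2(T^*M)$. The differential is $\mathrm d\colon\mathcal F_e\to L^2(T^*M)$, $\mathrm df=[f,M]$. *Theorem.* Let $\mathcal M$ be an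 $L^2$-normed $L^\infty$-module w.r.t. $\mu$, with pointwise norm $|\cdot|$, and let $\delta\colon\mathcal F_e\to\mathcal M$ be a linear map such that (a) $\mathcal M$ is generated by $\delta(\mathcal F_e)$, and (b) $|\delta f|=\Gamma_\mu(f)^{1/2}$ $\mu$-a.e. for every $f\in\mathcal F_e$. Then there exists a unique module isomorphism $\Phi\colon L^2(T^*M)\to\mathcal M$ such that $\Phi\circ\mathrm d=\delta$. -/

import Mathlib

open MeasureTheory Filter Topology Set
open scoped ENNReal NNReal

/-- A topological Lusin space: a Hausdorff space that is the continuous injective image of a Polish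
space; equivalently, some finer topology is Polish. -/
class LusinSpace (X : Type*) [t : TopologicalSpace X] : Prop extends T2Space X where
  exists_polish : ∃ t' : TopologicalSpace X, t' ≤ t ∧ @PolishSpace X t'

section Modules

variable {X : Type*} [MeasurableSpace X]

lemma simple_memLp_top (ν : Measure X) (s : SimpleFunc X ℝ) : MemLp s ∞ ν := by
  obtain ⟨C, hC⟩ := s.exists_forall_norm_le
  exact memLp_top_of_bound s.aestronglyMeasurable C (Eventually.of_forall hC)

/-- The class in `L^∞(ν)` of a simple function. -/
noncomputable def linfSimple (ν : Measure X) : SimpleFunc X ℝ →ₗ[ℝ] Lp ℝ ∞ ν where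
  toFun s := (simple_memLp_top ν s).toLp s
  map_add' _ _ := rfl
  map_smul' _ _ := rfl

lemma linfSimple_coe (ν : Measure X) (s : SimpleFunc X ℝ) : linfSimple ν s =ᵐ[ν] s :=
  (simple_memLp_top ν s).coeFn_toLp

/-- The class in `L^∞(ν)` of the indicator function of a measurable set. -/
noncomputable def linfIndicator (ν : Measure X) (A : Set X) (hA : MeasurableSet A) : Lp ℝ ∞ ν :=
  linfSimple ν (SimpleFunc.piecewise A hA (SimpleFunc.const X 1) (SimpleFunc.const X 0))

/-- The structure of an `L^∞(ν)`-premodule on a (real Banach) space `V`. -/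
structure LInftyPremodule (ν : Measure X) (V : Type*) [NormedAddCommGroup V]
    [NormedSpace ℝ V] where
  /-- multiplication by functions -/
  smul : Lp ℝ ∞ ν →ₗ[ℝ] V →ₗ[ℝ] V
  mul_smul : ∀ (f g : Lp ℝ ∞ ν) (v : V), smul (f • g : Lp ℝ ∞ ν) v = smul f (smul g v)
  one_smul : ∀ v : V, smul (linfIndicator ν univ MeasurableSet.univ) v = v

/-- The structure of an `L^p`-normed `L^∞`-module with respect to `ν` on a (real Banach) space
`V`. -/
structure LpNormedModule (p : ℝ≥0∞) (ν : Measure X) (V : Type*) [NormedAddCommGroup V]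
    [NormedSpace ℝ V] extends LInftyPremodule ν V where
  /-- the pointwise norm -/
  ptNorm : V → Lp ℝ p ν
  ptNorm_nonneg : ∀ v, ∀ᵐ x ∂ν, 0 ≤ ptNorm v x
  ptNorm_smul : ∀ (f : Lp ℝ ∞ ν) (v : V), ∀ᵐ x ∂ν, ptNorm (smul f v) x = |f x| * ptNorm v x
  norm_eq : ∀ v, ‖v‖ = ‖ptNorm v‖

namespace LInftyPremodule

variable {ν : Measure X} {V W : Type*} [NormedAddCommGroup V] [NormedSpace ℝ V]
  [NormedAddCommGroup W] [NormedSpace ℝ W]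

/-- The span of `S` on `X`: all `v` for which there is a measurable partition `A k` of `X` such
that each `1_{A k} v` is a finite `L^∞`-linear combination of elements of `S`. -/
def span (P : LInftyPremodule ν V) (S : Set V) : Set V :=
  {v | ∃ (A : ℕ → Set X) (hA : ∀ k, MeasurableSet (A k)),
    Pairwise (Function.onFun Disjoint A) ∧ ⋃ k, A k = univ ∧
    ∀ k, ∃ (n : ℕ) (f : Fin n → Lp ℝ ∞ ν) (w : Fin n → V), (∀ i, w i ∈ S) ∧
      P.smul (linfIndicator ν (A k) (hA k)) v = ∑ i, P.smul (f i) (w i)}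

/-- `V` is generated by `S`: the closure of the span of `S` is `V`. -/
def IsGeneratedBy (P : LInftyPremodule ν V) (S : Set V) : Prop := closure (P.span S) = univ

/-- A bounded linear map is a module morphism if it commutes with multiplication by `L^∞`. -/
def IsMorphism (P : LInftyPremodule ν V) (Q : LInftyPremodule ν W) (T : V →L[ℝ] W) : Prop :=
  ∀ (f : Lp ℝ ∞ ν) (v : V), T (P.smul f v) = Q.smul f (T v)

/-- A module isomorphism is a module morphism that has an inverse module morphism. -/
def IsIsomorphism (P : LInftyPremodule ν V) (Q : LInftyPremodule ν W) (T : V →L[ℝ] W) : Prop :=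
  P.IsMorphism Q T ∧ ∃ S : W →L[ℝ] V, Q.IsMorphism P S ∧
    T.comp S = ContinuousLinearMap.id ℝ W ∧ S.comp T = ContinuousLinearMap.id ℝ V

end LInftyPremodule

lemma linf_norm_bound {ν : Measure X} (f : Lp ℝ ∞ ν) : ∀ᵐ x ∂ν, |f x| ≤ ‖f‖ := by
  filter_upwards [ae_le_eLpNormEssSup (f := f) (μ := ν)] with x hx
  rw [Lp.norm_def, eLpNorm_exponent_top, ← Real.norm_eq_abs, ← toReal_enorm]
  refine ENNReal.toReal_mono ?_ hx
  have := Lp.eLpNorm_ne_top f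
  rwa [eLpNorm_exponent_top] at this

lemma linf_norm_le {ν : Measure X} (f : Lp ℝ ∞ ν) {C : ℝ} (hC0 : 0 ≤ C)
    (hC : ∀ᵐ x ∂ν, |f x| ≤ C) : ‖f‖ ≤ C := by
  rw [Lp.norm_def, eLpNorm_exponent_top]
  refine (ENNReal.toReal_mono ENNReal.ofReal_ne_top
    (eLpNormEssSup_le_of_ae_bound (C := C) ?_)).trans_eq (ENNReal.toReal_ofReal hC0)
  simpa only [Real.norm_eq_abs] using hC

lemma denseRange_linfSimple (ν : Measure X) : DenseRange (linfSimple ν) := by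
  refine Metric.denseRange_iff.2 fun f ε hε => ?_
  set C := ‖f‖ with hC
  have hC0 : 0 ≤ C := norm_nonneg _
  set δ := ε / 2 with hδ
  have hδ0 : 0 < δ := by positivity
  let c : X → ℝ := fun x => max (-C) (min C (f x))
  have hc : Measurable c :=
    measurable_const.max (measurable_const.min (Lp.stronglyMeasurable f).measurable)
  have hc1 : ∀ x, -C ≤ c x := fun x => le_max_left _ _
  have hc2 : ∀ x, c x ≤ C := fun x => max_le (by linarith) (min_le_left _ _)
  have hk : Measurable fun x => ⌊c x / δ⌋ := (hc.div_const δ).floor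
  have hfin : (range fun x => δ * (⌊c x / δ⌋ : ℝ)).Finite := by
    refine ((Set.finite_Icc ⌊-C / δ⌋ ⌊C / δ⌋).image fun k : ℤ => δ * (k : ℝ)).subset ?_
    rintro _ ⟨x, rfl⟩
    refine ⟨⌊c x / δ⌋, ⟨Int.floor_le_floor ?_, Int.floor_le_floor ?_⟩, rfl⟩
    · have := hc1 x; gcongr
    · have := hc2 x; gcongr
  have hm : Measurable fun x => δ * (⌊c x / δ⌋ : ℝ) :=
    measurable_const.mul ((measurable_from_top (f := fun k : ℤ => (k : ℝ))).comp hk)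
  let s : SimpleFunc X ℝ := ⟨fun x => δ * (⌊c x / δ⌋ : ℝ), fun r => hm (measurableSet_singleton r),
    hfin⟩
  refine ⟨s, ?_⟩
  rw [dist_eq_norm]
  refine lt_of_le_of_lt (b := δ) ?_ (by rw [hδ]; linarith)
  refine linf_norm_le _ hδ0.le ?_
  filter_upwards [linf_norm_bound f, Lp.coeFn_sub f (linfSimple ν s), linfSimple_coe ν s]
    with x h1 h2 h3
  rw [h2, Pi.sub_apply, h3]
  have h5 : c x = f x := by
    have := abs_le.1 h1
    simp only [c]
    rw [min_eq_right this.2, max_eq_right this.1]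
  have h6 : s x = δ * (⌊f x / δ⌋ : ℝ) := by rw [← h5]; rfl
  rw [h6, abs_le]
  have h7 := Int.floor_le (f x / δ)
  have h8 := Int.lt_floor_add_one (f x / δ)
  rw [le_div_iff₀ hδ0] at h7
  rw [div_lt_iff₀ hδ0] at h8
  constructor <;> nlinarith

lemma linfSimple_mul {ν : Measure X} (s t : SimpleFunc X ℝ) :
    (linfSimple ν s • linfSimple ν t : Lp ℝ ∞ ν) = linfSimple ν (s * t) := by
  refine Lp.ext ?_
  filter_upwards [Lp.coeFn_lpSMul (r := ∞) (linfSimple ν s) (linfSimple ν t),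
    linfSimple_coe ν s, linfSimple_coe ν t, linfSimple_coe ν (s * t)] with x h1 h2 h3 h4
  rw [h1, h4, Pi.smul_apply', h2, h3]
  rfl

lemma continuous_linf_mul (ν : Measure X) :
    Continuous fun p : Lp ℝ ∞ ν × Lp ℝ ∞ ν => (p.1 • p.2 : Lp ℝ ∞ ν) := by
  have h := ((ContinuousLinearMap.lsmul ℝ ℝ (E := ℝ)).holderL ν ∞ ∞ ∞).continuous₂
  refine h.congr fun p => Lp.ext ?_
  filter_upwards [(ContinuousLinearMap.lsmul ℝ ℝ (E := ℝ)).coeFn_holder (r := ∞) p.1 p.2,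
    Lp.coeFn_lpSMul (r := ∞) p.1 p.2] with x h1 h2
  rw [h2]
  exact h1

end Modules

/-- A symmetric Dirichlet form on `L²(X, m)`: a densely defined, nonnegative symmetric bilinear
form that is closed and Markovian. -/
structure DirichletForm {X : Type*} [MeasurableSpace X] (m : Measure X) where
  /-- the domain `𝓕` -/
  domain : Submodule ℝ (Lp ℝ 2 m)
  /-- the form `(f, g) ↦ 𝓔(f, g)` -/
  form : domain →ₗ[ℝ] domain →ₗ[ℝ] ℝ
  symm : ∀ f g, form f g = form g f
  nonneg : ∀ f, 0 ≤ form f f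
  dense : Dense (domain : Set (Lp ℝ 2 m))
  closed : ∀ u : ℕ → domain,
    (∀ ε > 0, ∃ N, ∀ j ≥ N, ∀ k ≥ N, ‖u j - u k‖ ^ 2 + form (u j - u k) (u j - u k) < ε) →
    ∃ f : domain, Tendsto (fun n => ‖u n - f‖ ^ 2 + form (u n - f) (u n - f)) atTop (𝓝 0)
  markov : ∀ f : domain, ∃ g : domain,
    (∀ᵐ x ∂m, (g : Lp ℝ 2 m) x = min (max ((f : Lp ℝ 2 m) x) 0) 1) ∧ form g g ≤ form f f

namespace DirichletForm

section Quasi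

variable {X : Type*} [TopologicalSpace X] [MeasurableSpace X] {m : Measure X}
  (E : DirichletForm m)

/-- `‖f‖²_𝓕 = ‖f‖²_{L²} + 𝓔(f, f)`. -/
noncomputable def energyOne (f : E.domain) : ℝ := ‖f‖ ^ 2 + E.form f f

/-- A subset of the domain is dense with respect to the norm `‖·‖_𝓕`. -/
def IsFormDense (D : Set E.domain) : Prop :=
  ∀ f : E.domain, ∀ ε > 0, ∃ g ∈ D, E.energyOne (f - g) < ε

/-- An `𝓔`-nest: an increasing sequence of closed sets `K n` such that the functions in the
domain which vanish a.e. outside some `K n` are dense in the domain. -/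
structure IsNest (K : ℕ → Set X) : Prop where
  mono : Monotone K
  isClosed : ∀ n, IsClosed (K n)
  dense : E.IsFormDense {f | ∃ n, ∀ᵐ x ∂m, x ∉ K n → (f : Lp ℝ 2 m) x = 0}

/-- `𝓔`-polar sets: subsets of `⋂ n, (K n)ᶜ` for some `𝓔`-nest `K`. -/
def IsPolar (N : Set X) : Prop := ∃ K, E.IsNest K ∧ N ⊆ ⋂ n, (K n)ᶜ

/-- `𝓔`-quasi-continuity: continuity on each member of some `𝓔`-nest. -/
def IsQuasiContinuous (u : X → ℝ) : Prop := ∃ K, E.IsNest K ∧ ∀ n, ContinuousOn u (K n)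

/-- `u` is an `𝓔`-quasi-continuous `m`-version of `f`. -/
def IsQCVersion (u : X → ℝ) (f : E.domain) : Prop :=
  E.IsQuasiContinuous u ∧ u =ᵐ[m] (f : Lp ℝ 2 m)

/-- Quasi-regularity. -/
structure IsQuasiRegular : Prop where
  compact_nest : ∃ K, E.IsNest K ∧ ∀ n, IsCompact (K n)
  dense_qc : ∃ D, E.IsFormDense D ∧ ∀ f ∈ D, ∃ u, E.IsQCVersion u f
  separating : ∃ (f : ℕ → E.domain) (u : ℕ → X → ℝ) (N : Set X),
    (∀ n, E.IsQCVersion (u n) (f n)) ∧ E.IsPolar N ∧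
      ∀ x ∉ N, ∀ y ∉ N, x ≠ y → ∃ n, u n x ≠ u n y

/-- The support of (the a.e. class of) `f`, i.e. the support of the measure `|f| m`. -/
noncomputable def funSupport (f : E.domain) : Set X :=
  (m.withDensity fun x => ‖(f : Lp ℝ 2 m) x‖ₑ).support

/-- Strong locality: `𝓔(f, g) = 0` whenever `f, g` have compact support and `f` is constant on a
neighborhood of the support of `g`. -/
def IsStronglyLocal : Prop :=
  ∀ f g : E.domain, IsCompact (E.funSupport f) → IsCompact (E.funSupport g) →
    (∃ U, IsOpen U ∧ E.funSupport g ⊆ U ∧ ∃ c : ℝ, ∀ᵐ x ∂m, x ∈ U → (f : Lp ℝ 2 m) x = c) →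
    E.form f g = 0

end Quasi

section Extended

variable {X : Type*} [MeasurableSpace X] {m : Measure X} (E : DirichletForm m)

/-- `𝓔`-Cauchy sequences in the domain. -/
def IsEnergyCauchy (u : ℕ → E.domain) : Prop :=
  ∀ ε > 0, ∃ N, ∀ j ≥ N, ∀ k ≥ N, E.form (u j - u k) (u j - u k) < ε

/-- `u n → f` in the extended domain: `u` is an `𝓔`-Cauchy sequence in the domain that converges
to `f` pointwise a.e. -/
def ConvergesTo (u : ℕ → E.domain) (f : X →ₘ[m] ℝ) : Prop :=
  E.IsEnergyCauchy u ∧ ∀ᵐ x ∂m, Tendsto (fun n => (u n : Lp ℝ 2 m) x) atTop (𝓝 (f x))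

lemma form_add_le (f g : E.domain) :
    E.form (f + g) (f + g) ≤ 2 * E.form f f + 2 * E.form g g := by
  have h := E.nonneg (f - g)
  simp only [map_add, map_sub, LinearMap.add_apply, LinearMap.sub_apply] at h ⊢
  linarith

/-- The extended domain `𝓕ₑ`, a linear space of a.e. classes of measurable functions. -/
noncomputable def extDomain : Submodule ℝ (X →ₘ[m] ℝ) where
  carrier := {f | ∃ u, E.ConvergesTo u f}
  zero_mem' := by
    refine ⟨fun _ => 0, fun ε hε => ⟨0, fun j _ k _ => by simpa using hε⟩, ?_⟩
    filter_upwards [AEEqFun.coeFn_zero (α := X) (μ := m) (β := ℝ)] with x h1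
    simp [h1]
  add_mem' := by
    rintro f g ⟨u, hu, hu'⟩ ⟨v, hv, hv'⟩
    refine ⟨fun n => u n + v n, fun ε hε => ?_, ?_⟩
    · obtain ⟨N, hN⟩ := hu (ε / 4) (by positivity)
      obtain ⟨M, hM⟩ := hv (ε / 4) (by positivity)
      refine ⟨max N M, fun j hj k hk => ?_⟩
      have h1 := hN j (le_trans (le_max_left _ _) hj) k (le_trans (le_max_left _ _) hk)
      have h2 := hM j (le_trans (le_max_right _ _) hj) k (le_trans (le_max_right _ _) hk)
      have h3 := E.form_add_le (u j - u k) (v j - v k)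
      rw [show u j + v j - (u k + v k) = (u j - u k) + (v j - v k) by abel]
      linarith
    · have h : ∀ n, ((u n + v n : E.domain) : Lp ℝ 2 m) =ᵐ[m]
          fun x => (u n : Lp ℝ 2 m) x + (v n : Lp ℝ 2 m) x := fun n => Lp.coeFn_add _ _
      filter_upwards [hu', hv', AEEqFun.coeFn_add f g, ae_all_iff.2 h] with x h1 h2 h3 h4
      simpa only [h3, h4, Pi.add_apply] using h1.add h2
  smul_mem' := by
    rintro c f ⟨u, hu, hu'⟩
    refine ⟨fun n => c • u n, fun ε hε => ?_, ?_⟩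
    · obtain ⟨N, hN⟩ := hu (ε / (c ^ 2 + 1)) (by positivity)
      refine ⟨N, fun j hj k hk => ?_⟩
      have h1 := hN j hj k hk
      have h0 := E.nonneg (u j - u k)
      rw [← smul_sub]
      rw [lt_div_iff₀ (by positivity)] at h1
      simp only [map_smul, LinearMap.smul_apply, smul_eq_mul]
      nlinarith
    · have h : ∀ n, ((c • u n : E.domain) : Lp ℝ 2 m) =ᵐ[m]
          fun x => c * (u n : Lp ℝ 2 m) x := fun n => Lp.coeFn_smul _ _
      filter_upwards [hu', AEEqFun.coeFn_smul c f, ae_all_iff.2 h] with x h1 h3 h4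
      simp only [h3, h4]
      exact h1.const_mul c

/-- The inclusion `𝓕 ⊆ 𝓕ₑ`. -/
noncomputable def toExt (f : E.domain) : E.extDomain :=
  ⟨((f : Lp ℝ 2 m) : X →ₘ[m] ℝ), fun _ => f,
    fun ε hε => ⟨0, fun j _ k _ => by simpa using hε⟩, by simp⟩

/-- Essentially bounded elements of the domain. -/
def IsBdd (f : E.domain) : Prop := ∃ C : ℝ, ∀ᵐ x ∂m, |(f : Lp ℝ 2 m) x| ≤ C

end Extended

section Energy

variable {X : Type*} [TopologicalSpace X] [MeasurableSpace X] {m : Measure X}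
  (E : DirichletForm m)

/-- `μ` is the energy measure of `𝓔`: a symmetric bilinear map on `𝓕ₑ × 𝓕ₑ` with values in the
finite signed Borel measures that do not charge `𝓔`-polar sets, with nonnegative diagonal, given on
bounded elements of the domain by
`2 ∫ h̃ dμ_{f,g} = 𝓔(f h, g) + 𝓔(g h, f) - 𝓔(f g, h)`,
and on `𝓕ₑ` by approximation. There is exactly one such map if `𝓔` is quasi-regular and
strongly local. (All products of bounded elements of the domain lie in the domain.) -/
structure IsEnergyMeasure
    (μ : E.extDomain →ₗ[ℝ] E.extDomain →ₗ[ℝ] SignedMeasure X) : Prop where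
  symm : ∀ f g, μ f g = μ g f
  nonneg : ∀ f A, 0 ≤ μ f f A
  polar : ∀ f g N, MeasurableSet N → E.IsPolar N → μ f g N = 0
  formula : ∀ f g h : E.domain, E.IsBdd f → E.IsBdd g → E.IsBdd h →
    ∀ fg fh gh : E.domain,
      (∀ᵐ x ∂m, (fg : Lp ℝ 2 m) x = (f : Lp ℝ 2 m) x * (g : Lp ℝ 2 m) x) →
      (∀ᵐ x ∂m, (fh : Lp ℝ 2 m) x = (f : Lp ℝ 2 m) x * (h : Lp ℝ 2 m) x) →
      (∀ᵐ x ∂m, (gh : Lp ℝ 2 m) x = (g : Lp ℝ 2 m) x * (h : Lp ℝ 2 m) x) →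
      ∀ h' : X → ℝ, E.IsQCVersion h' h →
        2 * ∫ᵛ x, h' x ∂•(μ (E.toExt f) (E.toExt g)) =
          E.form fh g + E.form gh f - E.form fg h
  approx : ∀ (f : E.extDomain) (u : ℕ → E.domain), E.ConvergesTo u f →
    ∀ A, MeasurableSet A →
      Tendsto (fun n => μ (E.toExt (u n)) (E.toExt (u n)) A) atTop (𝓝 (μ f f A))

open Classical in
/-- The energy measure `(f, g) ↦ μ_{f,g}` of `𝓔` (and, by convention, `0` if `𝓔` has none). -/
noncomputable def energy : E.extDomain →ₗ[ℝ] E.extDomain →ₗ[ℝ] SignedMeasure X :=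
  if h : ∃ μ, E.IsEnergyMeasure μ then h.choose else 0

lemma energy_symm (f g : E.extDomain) : E.energy f g = E.energy g f := by
  unfold energy
  split_ifs with h
  · exact h.choose_spec.symm f g
  · rfl

lemma energy_nonneg (f : E.extDomain) (A : Set X) : 0 ≤ E.energy f f A := by
  unfold energy
  split_ifs with h
  · exact h.choose_spec.nonneg f A
  · simp

lemma energy_approx (f : E.extDomain) (u : ℕ → E.domain) (hu : E.ConvergesTo u f)
    (A : Set X) (hA : MeasurableSet A) :
    Tendsto (fun n => E.energy (E.toExt (u n)) (E.toExt (u n)) A) atTop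
      (𝓝 (E.energy f f A)) := by
  unfold energy
  split_ifs with h
  · exact h.choose_spec.approx f u hu A hA
  · simp

/-- The energy measure `μ_f = μ_{f,f}` as a (finite, nonnegative) measure. -/
noncomputable def energyMeasure (f : E.extDomain) : Measure X :=
  (E.energy f f).toMeasureOfZeroLE univ MeasurableSet.univ
    (VectorMeasure.restrict_le_restrict_iff _ _ MeasurableSet.univ |>.2
      fun A _ _ => by simpa using E.energy_nonneg f A)

lemma energyMeasure_apply (f : E.extDomain) {A : Set X} (hA : MeasurableSet A) :
    E.energyMeasure f A = ENNReal.ofReal (E.energy f f A) := by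
  rw [energyMeasure, SignedMeasure.toMeasureOfZeroLE_apply _ _ _ hA]
  simp only [univ_inter]
  rw [ENNReal.ofReal, Real.toNNReal_of_nonneg (E.energy_nonneg f A)]

/-- `ν` is `𝓔`-dominant: it is `σ`-finite and `μ_f ≪ ν` for every `f ∈ 𝓕`. -/
structure IsDominant (ν : Measure X) : Prop where
  sigmaFinite : SigmaFinite ν
  absolutelyContinuous : ∀ f : E.domain, E.energyMeasure (E.toExt f) ≪ ν

/-- The carré du champ `Γ_ν(f, g)`, the density of `μ_{f,g}` with respect to `ν`. -/
noncomputable def carreDuChamp (ν : Measure X) (f g : E.extDomain) : X → ℝ :=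
  (E.energy f g).rnDeriv ν

lemma IsDominant.energyMeasure_absolutelyContinuous {E : DirichletForm m} {ν : Measure X}
    (hν : E.IsDominant ν) (f : E.extDomain) : E.energyMeasure f ≪ ν := by
  refine Measure.AbsolutelyContinuous.mk fun A hA h0 => ?_
  obtain ⟨u, hu⟩ := f.2
  have h1 := E.energy_approx f u hu A hA
  have h2 : ∀ n, E.energy (E.toExt (u n)) (E.toExt (u n)) A = 0 := fun n => by
    have h3 := hν.absolutelyContinuous (u n) h0
    rw [E.energyMeasure_apply _ hA, ENNReal.ofReal_eq_zero] at h3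
    exact le_antisymm h3 (E.energy_nonneg _ _)
  simp only [h2] at h1
  rw [E.energyMeasure_apply _ hA, tendsto_nhds_unique h1 tendsto_const_nhds, ENNReal.ofReal_zero]

lemma energyMeasure_smul (c : ℝ) (f : E.extDomain) {A : Set X} (hA : MeasurableSet A) :
    E.energyMeasure (c • f) A = ENNReal.ofReal (c ^ 2) * E.energyMeasure f A := by
  rw [E.energyMeasure_apply _ hA, E.energyMeasure_apply _ hA, ← ENNReal.ofReal_mul (sq_nonneg c)]
  simp only [map_smul, LinearMap.smul_apply, _root_.smul_apply, smul_eq_mul]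
  ring_nf

lemma energyMeasure_add_le {t : ℝ} (ht : 0 < t) (f g : E.extDomain) {A : Set X}
    (hA : MeasurableSet A) :
    E.energyMeasure (f + g) A ≤ ENNReal.ofReal (1 + t) * E.energyMeasure f A +
      ENNReal.ofReal (1 + t⁻¹) * E.energyMeasure g A := by
  have h1 : 0 ≤ 1 + t := by positivity
  have h2 : 0 ≤ 1 + t⁻¹ := by positivity
  have hf := E.energy_nonneg f A
  have hg := E.energy_nonneg g A
  rw [E.energyMeasure_apply _ hA, E.energyMeasure_apply _ hA, E.energyMeasure_apply _ hA,
    ← ENNReal.ofReal_mul h1, ← ENNReal.ofReal_mul h2, ← ENNReal.ofReal_add (by positivity)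
    (by positivity)]
  refine ENNReal.ofReal_le_ofReal ?_
  have h := E.energy_nonneg (t • f - g) A
  have hs := E.energy_symm g f
  simp only [map_smul, map_add, map_sub, LinearMap.smul_apply, LinearMap.add_apply,
    LinearMap.sub_apply, _root_.smul_apply, _root_.add_apply,
    _root_.sub_apply, smul_eq_mul, hs] at h ⊢
  have h3 : t⁻¹ * (t * (t * E.energy f f A - E.energy f g A) -
      (t * E.energy f g A - E.energy g g A)) =
      t * E.energy f f A - 2 * E.energy f g A + t⁻¹ * E.energy g g A := by
    field_simp
    ring
  have h4 := mul_nonneg (inv_pos.2 ht).le h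
  rw [h3] at h4
  linarith

end Energy

section Rep

variable {X : Type*} [MeasurableSpace X] {m : Measure X} (E : DirichletForm m)

/-- `(f i, A i)` is a representation of the function `F : X → 𝓕ₑ`: the `A i` form a Borel
partition of `X`, and `F = f i` on `A i`. -/
structure IsRep {ι : Type*} (F : X → E.extDomain) (f : ι → E.extDomain) (A : ι → Set X) :
    Prop where
  meas : ∀ i, MeasurableSet (A i)
  disj : Pairwise (Function.onFun Disjoint A)
  cover : ⋃ i, A i = univ
  eq : ∀ i, ∀ x ∈ A i, F x = f i

variable {E}

lemma IsRep.nat {ι : Type*} [Countable ι] {F : X → E.extDomain}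
    {f : ι → E.extDomain} {A : ι → Set X} (h : E.IsRep F f A) :
    ∃ (f' : ℕ → E.extDomain) (A' : ℕ → Set X), E.IsRep F f' A' := by
  obtain ⟨_⟩ := nonempty_encodable ι
  refine ⟨fun n => (Encodable.decode₂ ι n).elim 0 f,
    fun n => ⋃ b ∈ Encodable.decode₂ ι n, A b, ?_, ?_, ?_, ?_⟩
  · intro n
    exact Encodable.iUnion_decode₂_cases MeasurableSet.empty h.meas
  · exact Encodable.iUnion_decode₂_disjoint_on h.disj
  · rw [Encodable.iUnion_decode₂, h.cover]
  · intro n x hx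
    simp only [mem_iUnion] at hx
    obtain ⟨b, hb, hx⟩ := hx
    rw [Option.mem_def] at hb
    simp [hb, h.eq b x hx]

lemma IsRep.inter {ι κ : Type*} {F G : X → E.extDomain} {f : ι → E.extDomain} {A : ι → Set X}
    {g : κ → E.extDomain} {B : κ → Set X} (hF : E.IsRep F f A) (hG : E.IsRep G g B) :
    E.IsRep F (fun p : ι × κ => f p.1) (fun p => A p.1 ∩ B p.2) ∧
    E.IsRep G (fun p : ι × κ => g p.2) (fun p => A p.1 ∩ B p.2) ∧
    E.IsRep (F + G) (fun p : ι × κ => f p.1 + g p.2) (fun p => A p.1 ∩ B p.2) := by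
  have h1 : ∀ p : ι × κ, MeasurableSet (A p.1 ∩ B p.2) := fun p =>
    (hF.meas _).inter (hG.meas _)
  have h2 : Pairwise (Function.onFun Disjoint fun p : ι × κ => A p.1 ∩ B p.2) := by
    rintro ⟨i, j⟩ ⟨i', j'⟩ hne
    by_cases hi : i = i'
    · have hj : j ≠ j' := fun hj => hne (by rw [hi, hj])
      exact (hG.disj hj).mono inter_subset_right inter_subset_right
    · exact (hF.disj hi).mono inter_subset_left inter_subset_left
  have h3 : ⋃ p : ι × κ, A p.1 ∩ B p.2 = univ := by
    refine eq_univ_of_forall fun x => ?_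
    obtain ⟨i, hi⟩ := mem_iUnion.1 (hF.cover ▸ mem_univ x)
    obtain ⟨j, hj⟩ := mem_iUnion.1 (hG.cover ▸ mem_univ x)
    exact mem_iUnion.2 ⟨(i, j), hi, hj⟩
  refine ⟨⟨h1, h2, h3, fun p x hx => hF.eq _ x hx.1⟩, ⟨h1, h2, h3, fun p x hx => hG.eq _ x hx.2⟩,
    ⟨h1, h2, h3, fun p x hx => ?_⟩⟩
  simp [hF.eq _ x hx.1, hG.eq _ x hx.2]

lemma IsRep.smul {ι : Type*} {F : X → E.extDomain} {f : ι → E.extDomain} {A : ι → Set X}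
    (hF : E.IsRep F f A) (c : ℝ) : E.IsRep (c • F) (fun i => c • f i) A :=
  ⟨hF.meas, hF.disj, hF.cover, fun i x hx => by simp [hF.eq i x hx]⟩

lemma isRep_const (f : E.extDomain) :
    E.IsRep (fun _ => f) (fun _ : Unit => f) (fun _ => univ) :=
  ⟨fun _ => MeasurableSet.univ, fun i j h => (h (Subsingleton.elim i j)).elim,
    iUnion_const univ, fun _ _ _ => rfl⟩

/-- Multiplication of `F` by a simple function `s`. -/
lemma IsRep.simple {ι : Type*} {F : X → E.extDomain} {f : ι → E.extDomain} {A : ι → Set X}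
    (hF : E.IsRep F f A) (s : SimpleFunc X ℝ) :
    E.IsRep (fun x => s x • F x) (fun p : ι × s.range => (p.2 : ℝ) • f p.1)
      (fun p => A p.1 ∩ s ⁻¹' {(p.2 : ℝ)}) := by
  refine ⟨fun p => (hF.meas _).inter (s.measurableSet_fiber _), ?_, ?_, ?_⟩
  · rintro ⟨i, j⟩ ⟨i', j'⟩ hne
    by_cases hi : i = i'
    · have hj : (j : ℝ) ≠ j' := fun hj => hne (by rw [hi, Subtype.ext hj])
      refine (Disjoint.preimage s ?_).mono inter_subset_right inter_subset_right
      simpa using hj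
    · exact (hF.disj hi).mono inter_subset_left inter_subset_left
  · refine eq_univ_of_forall fun x => ?_
    obtain ⟨i, hi⟩ := mem_iUnion.1 (hF.cover ▸ mem_univ x)
    exact mem_iUnion.2 ⟨(i, ⟨s x, s.mem_range_self x⟩), hi, rfl⟩
  · rintro ⟨i, r⟩ x ⟨hx, hr⟩
    have : s x = r := hr
    simp [hF.eq _ x hx, this]

end Rep

section PreCotangent

variable {X : Type*} [TopologicalSpace X] [MeasurableSpace X] {m : Measure X}
  (E : DirichletForm m)

/-- The sum of the energies `μ_f[F = f]` over all values `f` of `F : X → 𝓕ₑ`. -/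
noncomputable def stepEnergy (F : X → E.extDomain) : ℝ≥0∞ :=
  ∑' h, E.energyMeasure h (F ⁻¹' {h})

variable {E}

/-- For every representation `(f i, A i)` of `F`, the energy of `F` is `∑ i, μ_{f i}[A i]`. -/
lemma IsRep.stepEnergy_eq {ι : Type*} [Countable ι] {F : X → E.extDomain}
    {f : ι → E.extDomain} {A : ι → Set X} (h : E.IsRep F f A) :
    E.stepEnergy F = ∑' i, E.energyMeasure (f i) (A i) := by
  classical
  have key : ∀ k, E.energyMeasure k (F ⁻¹' {k}) =
      ∑' i, if f i = k then E.energyMeasure (f i) (A i) else 0 := by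
    intro k
    have h1 : F ⁻¹' {k} = ⋃ i, (if f i = k then A i else ∅) := by
      ext x
      simp only [mem_preimage, mem_singleton_iff, mem_iUnion]
      constructor
      · intro hx
        have : x ∈ ⋃ i, A i := h.cover ▸ mem_univ x
        obtain ⟨i, hi⟩ := mem_iUnion.1 this
        exact ⟨i, by rw [if_pos ((h.eq i x hi).symm.trans hx)]; exact hi⟩
      · rintro ⟨i, hi⟩
        split_ifs at hi with hk
        · exact (h.eq i x hi).trans hk
        · exact hi.elim
    rw [h1, measure_iUnion]
    · refine tsum_congr fun i => ?_
      split_ifs with hk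
      · rw [hk]
      · simp
    · intro i j hij
      have := h.disj hij
      simp only [Function.onFun] at this ⊢
      split_ifs <;> simp [this]
    · intro i
      split_ifs
      · exact h.meas i
      · exact MeasurableSet.empty
  unfold stepEnergy
  simp_rw [key]
  rw [ENNReal.tsum_comm]
  refine tsum_congr fun i => ?_
  rw [tsum_eq_single (f i)]
  · simp
  · intro k hk
    rw [if_neg (fun h => hk h.symm)]

lemma stepEnergy_add_le {ι κ : Type*} [Countable ι] [Countable κ] {F G : X → E.extDomain}
    {f : ι → E.extDomain} {A : ι → Set X} {g : κ → E.extDomain} {B : κ → Set X}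
    (hF : E.IsRep F f A) (hG : E.IsRep G g B) {t : ℝ} (ht : 0 < t) :
    E.stepEnergy (F + G) ≤ ENNReal.ofReal (1 + t) * E.stepEnergy F +
      ENNReal.ofReal (1 + t⁻¹) * E.stepEnergy G := by
  obtain ⟨h1, h2, h3⟩ := hF.inter hG
  rw [h1.stepEnergy_eq, h2.stepEnergy_eq, h3.stepEnergy_eq, ← ENNReal.tsum_mul_left,
    ← ENNReal.tsum_mul_left, ← ENNReal.tsum_add]
  exact ENNReal.tsum_le_tsum fun p => E.energyMeasure_add_le ht _ _ (h1.meas p)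

lemma stepEnergy_smul {ι : Type*} [Countable ι] {F : X → E.extDomain} {f : ι → E.extDomain}
    {A : ι → Set X} (hF : E.IsRep F f A) (c : ℝ) :
    E.stepEnergy (c • F) = ENNReal.ofReal (c ^ 2) * E.stepEnergy F := by
  rw [hF.stepEnergy_eq, (hF.smul c).stepEnergy_eq, ← ENNReal.tsum_mul_left]
  exact tsum_congr fun i => E.energyMeasure_smul c _ (hF.meas i)

lemma stepEnergy_simple_le {ν : Measure X} (hν : E.IsDominant ν) {ι : Type*} [Countable ι]
    {F : X → E.extDomain} {f : ι → E.extDomain} {A : ι → Set X} (hF : E.IsRep F f A)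
    (s : SimpleFunc X ℝ) {C : ℝ} (hC : ∀ᵐ x ∂ν, |s x| ≤ C) :
    E.stepEnergy (fun x => s x • F x) ≤ ENNReal.ofReal (C ^ 2) * E.stepEnergy F := by
  have hF' : E.IsRep F (fun p : ι × s.range => f p.1) (fun p => A p.1 ∩ s ⁻¹' {(p.2 : ℝ)}) := by
    have h := hF.simple s
    exact ⟨h.meas, h.disj, h.cover, fun p x hx => hF.eq _ x hx.1⟩
  rw [(hF.simple s).stepEnergy_eq, hF'.stepEnergy_eq, ← ENNReal.tsum_mul_left]
  refine ENNReal.tsum_le_tsum fun p => ?_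
  rw [E.energyMeasure_smul _ _ (hF'.meas p)]
  by_cases hp : |(p.2 : ℝ)| ≤ C
  · refine mul_le_mul_left (ENNReal.ofReal_le_ofReal ?_) _
    exact sq_le_sq' (by linarith [neg_abs_le (p.2 : ℝ)]) ((le_abs_self _).trans hp)
  · have h0 : ν (A p.1 ∩ s ⁻¹' {(p.2 : ℝ)}) = 0 := by
      refine measure_mono_null ?_ (ae_iff.1 hC)
      rintro x ⟨-, hx⟩
      have hx' : s x = p.2 := hx
      simpa [hx'] using hp
    rw [hν.energyMeasure_absolutelyContinuous _ h0]
    simp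

variable (E)

/-- The pre-cotangent module. A sequence `(f i, A i)` with a Borel partition `A i` of `X`,
`f i ∈ 𝓕ₑ` and `∑ i, μ_{f i}[A i] < ∞` is recorded as the function `X → 𝓕ₑ` equal to `f i` on
`A i`; the operations are then pointwise. -/
noncomputable def preCotangent : Submodule ℝ (X → E.extDomain) where
  carrier := {F | ∃ (f : ℕ → E.extDomain) (A : ℕ → Set X), E.IsRep F f A ∧
    ∑' i, E.energyMeasure (f i) (A i) < ∞}
  zero_mem' := by
    obtain ⟨f, A, h⟩ := (isRep_const (E := E) 0).nat
    refine ⟨f, A, h, ?_⟩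
    have h0 := E.energyMeasure_smul 0 0 (A := univ) MeasurableSet.univ
    rw [← h.stepEnergy_eq, (isRep_const (E := E) 0).stepEnergy_eq]
    simp at h0
    simp [h0]
  add_mem' := by
    rintro F G ⟨f, A, hF, hF'⟩ ⟨g, B, hG, hG'⟩
    obtain ⟨k, D, h⟩ := (hF.inter hG).2.2.nat
    refine ⟨k, D, h, ?_⟩
    rw [← hF.stepEnergy_eq] at hF'
    rw [← hG.stepEnergy_eq] at hG'
    rw [← h.stepEnergy_eq]
    refine (stepEnergy_add_le hF hG one_pos).trans_lt ?_
    finiteness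
  smul_mem' := by
    rintro c F ⟨f, A, hF, hF'⟩
    refine ⟨_, A, hF.smul c, ?_⟩
    rw [← hF.stepEnergy_eq] at hF'
    rw [← (hF.smul c).stepEnergy_eq, stepEnergy_smul hF]
    finiteness

/-- The pre-cotangent module as a type, with the seminorm
`‖(f i, A i)‖² = ∑ i, μ_{f i}[A i]` (see `IsRep.stepEnergy_eq`). Two elements are equivalent,
`μ_{f i - g j}[A i ∩ B j] = 0` for all `i, j`, exactly if their difference has seminorm `0`. -/
def PreCotangent : Type _ := E.preCotangent

noncomputable instance : AddCommGroup E.PreCotangent :=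
  inferInstanceAs (AddCommGroup E.preCotangent)

noncomputable instance : Module ℝ E.PreCotangent :=
  inferInstanceAs (Module ℝ E.preCotangent)

/-- The function `X → 𝓕ₑ` underlying an element of the pre-cotangent module. -/
def PreCotangent.toFun {E : DirichletForm m} (F : E.PreCotangent) : X → E.extDomain := F.1

noncomputable instance : Norm E.PreCotangent := ⟨fun F => √(E.stepEnergy F.toFun).toReal⟩

variable {E}

lemma PreCotangent.norm_def (F : E.PreCotangent) : ‖F‖ = √(E.stepEnergy F.toFun).toReal := rfl

lemma PreCotangent.stepEnergy_ne_top (F : E.PreCotangent) : E.stepEnergy F.toFun ≠ ∞ := by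
  obtain ⟨f, A, hF, hF'⟩ := F.2
  exact (hF.stepEnergy_eq.trans_lt hF').ne

lemma PreCotangent.norm_sq (F : E.PreCotangent) : ‖F‖ ^ 2 = (E.stepEnergy F.toFun).toReal := by
  rw [norm_def, Real.sq_sqrt ENNReal.toReal_nonneg]

lemma preCotangent_core : SeminormedSpace.Core ℝ E.PreCotangent where
  norm_nonneg F := Real.sqrt_nonneg _
  norm_smul c F := by
    obtain ⟨f, A, hF, -⟩ := F.2
    have h : E.stepEnergy (c • F).toFun = ENNReal.ofReal (c ^ 2) * E.stepEnergy F.toFun :=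
      stepEnergy_smul hF c
    rw [PreCotangent.norm_def, PreCotangent.norm_def, h, ENNReal.toReal_mul,
      ENNReal.toReal_ofReal (sq_nonneg c), Real.sqrt_mul (sq_nonneg c), Real.sqrt_sq_eq_abs,
      Real.norm_eq_abs]
  norm_triangle F G := by
    obtain ⟨f, A, hF, -⟩ := F.2
    obtain ⟨g, B, hG, -⟩ := G.2
    refine le_of_forall_pos_le_add fun ε hε => ?_
    have hF0 : 0 ≤ ‖F‖ := Real.sqrt_nonneg _
    have hG0 : 0 ≤ ‖G‖ := Real.sqrt_nonneg _
    set a := ‖F‖ + ε / 2 with ha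
    set b := ‖G‖ + ε / 2 with hb
    have ha0 : 0 < a := by positivity
    have hb0 : 0 < b := by positivity
    have h := stepEnergy_add_le hF hG (div_pos hb0 ha0)
    have hFt : E.stepEnergy F.toFun ≠ ∞ := F.stepEnergy_ne_top
    have hGt : E.stepEnergy G.toFun ≠ ∞ := G.stepEnergy_ne_top
    have h' : (E.stepEnergy (F + G).toFun).toReal ≤
        (1 + b / a) * (E.stepEnergy F.toFun).toReal +
          (1 + (b / a)⁻¹) * (E.stepEnergy G.toFun).toReal := by
      have h2 := ENNReal.toReal_mono (ENNReal.add_ne_top.2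
        ⟨ENNReal.mul_ne_top ENNReal.ofReal_ne_top hFt,
          ENNReal.mul_ne_top ENNReal.ofReal_ne_top hGt⟩) h
      rw [ENNReal.toReal_add (ENNReal.mul_ne_top ENNReal.ofReal_ne_top hFt)
        (ENNReal.mul_ne_top ENNReal.ofReal_ne_top hGt), ENNReal.toReal_mul, ENNReal.toReal_mul,
        ENNReal.toReal_ofReal (by positivity), ENNReal.toReal_ofReal (by positivity)] at h2
      exact h2
    rw [← PreCotangent.norm_sq, ← PreCotangent.norm_sq, ← PreCotangent.norm_sq] at h'
    have hFa : ‖F‖ ^ 2 ≤ a ^ 2 := pow_le_pow_left₀ hF0 (by linarith) 2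
    have hGb : ‖G‖ ^ 2 ≤ b ^ 2 := pow_le_pow_left₀ hG0 (by linarith) 2
    have h3 : ‖F + G‖ ^ 2 ≤ (a + b) ^ 2 := by
      calc ‖F + G‖ ^ 2 ≤ (1 + b / a) * ‖F‖ ^ 2 + (1 + (b / a)⁻¹) * ‖G‖ ^ 2 := h'
        _ ≤ (1 + b / a) * a ^ 2 + (1 + (b / a)⁻¹) * b ^ 2 := by gcongr
        _ = (a + b) ^ 2 := by field_simp; ring
    have h4 := abs_le_of_sq_le_sq h3 (by positivity)
    have : a + b = ‖F‖ + ‖G‖ + ε := by rw [ha, hb]; ring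
    linarith [le_abs_self ‖F + G‖]

noncomputable instance : SeminormedAddCommGroup E.PreCotangent :=
  SeminormedAddCommGroup.ofCore preCotangent_core

noncomputable instance : NormedSpace ℝ E.PreCotangent where
  norm_smul_le c F := (preCotangent_core.norm_smul c F).le

variable (E)

/-- The cotangent module `L²(T*X)`: the completion of the quotient of the pre-cotangent module by
the elements of seminorm `0`. -/
abbrev Cotangent : Type _ := UniformSpace.Completion E.PreCotangent

/-- The element `(f, X)` of the pre-cotangent module. -/
noncomputable def preD : E.extDomain →ₗ[ℝ] E.PreCotangent where
  toFun f := ⟨fun _ => f, by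
    obtain ⟨g, A, h⟩ := (isRep_const f).nat
    refine ⟨g, A, h, ?_⟩
    rw [← h.stepEnergy_eq, (isRep_const f).stepEnergy_eq, tsum_fintype]
    simp [E.energyMeasure_apply]⟩
  map_add' f g := rfl
  map_smul' c f := rfl

/-- The differential `d f = [f, X]`. -/
noncomputable def d : E.extDomain →ₗ[ℝ] E.Cotangent :=
  (UniformSpace.Completion.toComplL (𝕜 := ℝ) (E := E.PreCotangent)).toLinearMap ∘ₗ E.preD

end PreCotangent

section Action

variable {X : Type*} [TopologicalSpace X] [MeasurableSpace X] {m : Measure X}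
  {E : DirichletForm m} {ν : Measure X}

/-- The action of simple functions on the pre-cotangent module, `s [f i, A i] = [r f i, A i ∩ {s = r}]`,
is pointwise multiplication. -/
noncomputable def simpleMul (hν : E.IsDominant ν) (s : SimpleFunc X ℝ) :
    E.PreCotangent →ₗ[ℝ] E.PreCotangent where
  toFun F := ⟨fun x => s x • F.toFun x, by
    obtain ⟨f, A, hF, -⟩ := F.2
    obtain ⟨g, B, h⟩ := (hF.simple s).nat
    refine ⟨g, B, h, ?_⟩
    rw [← h.stepEnergy_eq]
    have h1 : ∀ᵐ x ∂ν, |s x| ≤ ‖linfSimple ν s‖ := by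
      filter_upwards [linf_norm_bound (linfSimple ν s), linfSimple_coe ν s] with x h1 h2
      rwa [h2] at h1
    refine (stepEnergy_simple_le hν hF s h1).trans_lt ?_
    exact ENNReal.mul_lt_top ENNReal.ofReal_lt_top F.stepEnergy_ne_top.lt_top⟩
  map_add' F G := Subtype.ext (funext fun x => smul_add (s x) (F.toFun x) (G.toFun x))
  map_smul' c F := Subtype.ext (funext fun x => smul_comm (s x) c (F.toFun x))

lemma norm_simpleMul_le (hν : E.IsDominant ν) (s : SimpleFunc X ℝ) (F : E.PreCotangent) :
    ‖simpleMul hν s F‖ ≤ ‖linfSimple ν s‖ * ‖F‖ := by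
  obtain ⟨f, A, hF, -⟩ := F.2
  have h1 : ∀ᵐ x ∂ν, |s x| ≤ ‖linfSimple ν s‖ := by
    filter_upwards [linf_norm_bound (linfSimple ν s), linfSimple_coe ν s] with x h1 h2
    rwa [h2] at h1
  have h2 : E.stepEnergy (simpleMul hν s F).toFun ≤
    ENNReal.ofReal (‖linfSimple ν s‖ ^ 2) * E.stepEnergy F.toFun :=
    stepEnergy_simple_le hν hF s h1
  have h3 := ENNReal.toReal_mono
    (ENNReal.mul_ne_top ENNReal.ofReal_ne_top F.stepEnergy_ne_top) h2
  rw [ENNReal.toReal_mul, ENNReal.toReal_ofReal (sq_nonneg _)] at h3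
  rw [PreCotangent.norm_def, PreCotangent.norm_def]
  refine (Real.sqrt_le_sqrt h3).trans_eq ?_
  rw [Real.sqrt_mul (sq_nonneg _), Real.sqrt_sq (norm_nonneg _)]

/-- The action of a simple function on the cotangent module. -/
noncomputable def simpleActAux (hν : E.IsDominant ν) (s : SimpleFunc X ℝ) :
    E.Cotangent →L[ℝ] E.Cotangent :=
  ((simpleMul hν s).mkContinuous _ (norm_simpleMul_le hν s)).completion

lemma simpleActAux_coe (hν : E.IsDominant ν) (s : SimpleFunc X ℝ) (F : E.PreCotangent) :
    simpleActAux hν s (F : E.Cotangent) = ((simpleMul hν s F : E.PreCotangent) : E.Cotangent) :=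
  ContinuousLinearMap.completion_apply_coe _ _

lemma simpleMul_add (hν : E.IsDominant ν) (s t : SimpleFunc X ℝ) (F : E.PreCotangent) :
    simpleMul hν (s + t) F = simpleMul hν s F + simpleMul hν t F :=
  Subtype.ext (funext fun x => add_smul (s x) (t x) (F.toFun x))

lemma simpleMul_smul (hν : E.IsDominant ν) (c : ℝ) (s : SimpleFunc X ℝ) (F : E.PreCotangent) :
    simpleMul hν (c • s) F = c • simpleMul hν s F :=
  Subtype.ext (funext fun x => mul_smul c (s x) (F.toFun x))

lemma simpleMul_mul (hν : E.IsDominant ν) (s t : SimpleFunc X ℝ) (F : E.PreCotangent) :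
    simpleMul hν (s * t) F = simpleMul hν s (simpleMul hν t F) :=
  Subtype.ext (funext fun x => mul_smul (s x) (t x) (F.toFun x))

lemma simpleMul_one (hν : E.IsDominant ν) (F : E.PreCotangent) : simpleMul hν 1 F = F :=
  Subtype.ext (funext fun x => one_smul ℝ (F.toFun x))

lemma ext_cotangent {S T : E.Cotangent →L[ℝ] E.Cotangent}
    (h : ∀ F : E.PreCotangent, S (F : E.Cotangent) = T (F : E.Cotangent)) : S = T := by
  ext ω
  induction ω using UniformSpace.Completion.induction_on with
  | hp => exact isClosed_eq S.continuous T.continuous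
  | ih F => exact h F

/-- The action of simple functions on the cotangent module. -/
noncomputable def simpleAct (hν : E.IsDominant ν) :
    SimpleFunc X ℝ →ₗ[ℝ] (E.Cotangent →L[ℝ] E.Cotangent) where
  toFun s := simpleActAux hν s
  map_add' s t := ext_cotangent fun F => by
    rw [simpleActAux_coe, simpleMul_add, UniformSpace.Completion.coe_add, ← simpleActAux_coe,
      ← simpleActAux_coe]
    rfl
  map_smul' c s := ext_cotangent fun F => by
    rw [simpleActAux_coe, simpleMul_smul, UniformSpace.Completion.coe_smul, ← simpleActAux_coe]
    rfl

lemma simpleAct_coe (hν : E.IsDominant ν) (s : SimpleFunc X ℝ) (F : E.PreCotangent) :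
    simpleAct hν s (F : E.Cotangent) = ((simpleMul hν s F : E.PreCotangent) : E.Cotangent) :=
  simpleActAux_coe hν s F

lemma norm_simpleAct_le (hν : E.IsDominant ν) (s : SimpleFunc X ℝ) :
    ‖simpleAct hν s‖ ≤ 1 * ‖linfSimple ν s‖ := by
  rw [one_mul]
  refine ContinuousLinearMap.opNorm_le_bound _ (norm_nonneg _) fun ω => ?_
  induction ω using UniformSpace.Completion.induction_on with
  | hp => exact isClosed_le (by fun_prop) (by fun_prop)
  | ih F =>
    rw [simpleAct_coe, UniformSpace.Completion.norm_coe, UniformSpace.Completion.norm_coe]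
    exact norm_simpleMul_le hν s F

/-- The action of `L^∞(ν)` on the cotangent module: the continuous extension of the action of
simple functions. -/
noncomputable def linfAct (hν : E.IsDominant ν) :
    Lp ℝ ∞ ν →L[ℝ] (E.Cotangent →L[ℝ] E.Cotangent) :=
  (simpleAct hν).extendOfNorm (linfSimple ν)

lemma linfAct_simple (hν : E.IsDominant ν) (s : SimpleFunc X ℝ) :
    linfAct hν (linfSimple ν s) = simpleAct hν s :=
  LinearMap.extendOfNorm_eq (denseRange_linfSimple ν) ⟨1, norm_simpleAct_le hν⟩ s

lemma simpleAct_mul (hν : E.IsDominant ν) (s t : SimpleFunc X ℝ) :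
    simpleAct hν (s * t) = (simpleAct hν s).comp (simpleAct hν t) :=
  ext_cotangent fun F => by
    rw [ContinuousLinearMap.comp_apply, simpleAct_coe, simpleAct_coe, simpleAct_coe, simpleMul_mul]

lemma simpleAct_one (hν : E.IsDominant ν) :
    simpleAct hν 1 = ContinuousLinearMap.id ℝ E.Cotangent :=
  ext_cotangent fun F => by
    rw [simpleAct_coe, simpleMul_one, ContinuousLinearMap.id_apply]

lemma linfAct_mul (hν : E.IsDominant ν) (f g : Lp ℝ ∞ ν) :
    linfAct hν (f • g : Lp ℝ ∞ ν) = (linfAct hν f).comp (linfAct hν g) := by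
  have hd := (denseRange_linfSimple ν).prodMap (denseRange_linfSimple ν)
  refine hd.induction_on (p := fun q : Lp ℝ ∞ ν × Lp ℝ ∞ ν =>
    linfAct hν (q.1 • q.2 : Lp ℝ ∞ ν) = (linfAct hν q.1).comp (linfAct hν q.2)) (f, g) ?_ ?_
  · refine isClosed_eq ((linfAct hν).continuous.comp (continuous_linf_mul ν)) ?_
    fun_prop
  · rintro ⟨s, t⟩
    simp only [Prod.map_apply, linfSimple_mul, linfAct_simple, simpleAct_mul]

variable (E) in
/-- The cotangent module as an `L^∞`-(pre)module with respect to an `𝓔`-dominant measure. -/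
noncomputable def cotangentModule (hν : E.IsDominant ν) : LInftyPremodule ν E.Cotangent where
  smul := ContinuousLinearMap.coeLM ℝ ∘ₗ (linfAct hν).toLinearMap
  mul_smul f g ω := by
    change linfAct hν (f • g : Lp ℝ ∞ ν) ω = linfAct hν f (linfAct hν g ω)
    rw [linfAct_mul]
    rfl
  one_smul ω := by
    change linfAct hν (linfIndicator ν univ MeasurableSet.univ) ω = ω
    rw [linfIndicator, linfAct_simple]
    have : (SimpleFunc.piecewise univ MeasurableSet.univ (SimpleFunc.const X 1)
        (SimpleFunc.const X 0) : SimpleFunc X ℝ) = 1 := by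
      ext x; simp
    rw [this, simpleAct_one, ContinuousLinearMap.id_apply]

end Action

end DirichletForm

/-! An element of the pre-cotangent module is a function `F : X → 𝓕ₑ` that is constant on each set
of a countable Borel partition, with value `f i` on `A i`. A module morphism `Φ` with `Φ ∘ d = δ`
must send it to the vector `v` with `1_{A i} v = 1_{A i} δ (f i)` for all `i`. Everything rests on
the fact that such a `v` exists, is unique, and has the right norm. In an `L²`-normed module, `‖v‖²`
is the sum of the `‖1_{A i} v‖²`. Hence vectors are determined by their pieces (`eq_of_res_eq`), and
square-summable pieces can be glued (`exists_hasSum_res`). By hypothesis (b) and Radon–Nikodym,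
`‖1_A δ f‖² = ∫_A Γ(f) dμ`, which is the energy measure of `f` on `A` (`enorm_res_sq`). So the
finite energy of `F` is exactly the gluing condition, and `‖v‖ = ‖F‖`. The property `IsValue`
describes `v` without choosing a representation of `F`, which makes linearity of `F ↦ v` a matter of
uniqueness. The resulting isometry extends to the completion and commutes with `L^∞`, because it
does so for simple functions, which are dense. Its range is closed and contains the span of `δ(𝓕ₑ)`,
so (a) makes it onto. Any other morphism with the required property agrees with it on the dense
image of the pre-cotangent module. -/

section Restriction

/-! ### Multiplication by indicator functions -/

variable {X : Type*} [MeasurableSpace X] {ν : Measure X}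

lemma coeFn_linfIndicator {A : Set X} (hA : MeasurableSet A) :
    linfIndicator ν A hA =ᵐ[ν] A.indicator 1 := by
  filter_upwards [linfSimple_coe ν
    (SimpleFunc.piecewise A hA (SimpleFunc.const X 1) (SimpleFunc.const X 0))] with x hx
  rw [linfIndicator, hx]
  by_cases h : x ∈ A <;> simp [h]

lemma linfIndicator_smul_linfIndicator {A B : Set X} (hA : MeasurableSet A)
    (hB : MeasurableSet B) :
    (linfIndicator ν A hA • linfIndicator ν B hB : Lp ℝ ∞ ν) =
      linfIndicator ν (A ∩ B) (hA.inter hB) := by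
  rw [linfIndicator, linfIndicator, linfSimple_mul, linfIndicator]
  congr 1
  ext x
  by_cases h : x ∈ A <;> by_cases h' : x ∈ B <;> simp [h, h']

lemma linfIndicator_eq_zero {A : Set X} (hA : MeasurableSet A) (h : A = ∅) :
    linfIndicator ν A hA = 0 := by
  subst h
  rw [linfIndicator, ← map_zero (linfSimple ν)]
  congr 1
  ext x
  simp

namespace LInftyPremodule

variable {V : Type*} [NormedAddCommGroup V] [NormedSpace ℝ V] (P : LInftyPremodule ν V)

/-- Multiplication by the indicator function of a measurable set. -/
noncomputable def res {A : Set X} (hA : MeasurableSet A) : V →ₗ[ℝ] V :=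
  P.smul (linfIndicator ν A hA)

lemma res_res {A B : Set X} (hA : MeasurableSet A) (hB : MeasurableSet B) (v : V) :
    P.res hA (P.res hB v) = P.res (hA.inter hB) v := by
  rw [res, res, ← P.mul_smul, linfIndicator_smul_linfIndicator, res]

lemma res_of_eq_empty {A : Set X} (hA : MeasurableSet A) (h : A = ∅) (v : V) :
    P.res hA v = 0 := by
  rw [res, linfIndicator_eq_zero hA h, map_zero, LinearMap.zero_apply]

lemma res_res_self {A : Set X} (hA : MeasurableSet A) (v : V) :
    P.res hA (P.res hA v) = P.res hA v := by
  rw [res_res]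
  simp only [inter_self]

lemma res_inter_congr {A B : Set X} (hA : MeasurableSet A) (hB : MeasurableSet B) {v w : V}
    (h : P.res hA v = P.res hA w) : P.res (hA.inter hB) v = P.res (hA.inter hB) w := by
  have key : ∀ u, P.res (hA.inter hB) u = P.res hB (P.res hA u) := fun u => by
    rw [res_res]
    simp only [inter_comm]
  rw [key, key, h]

end LInftyPremodule

/-! ### Orthogonality, locality and gluing in normed modules -/

namespace LpNormedModule

variable {V : Type*} [NormedAddCommGroup V] [NormedSpace ℝ V]

section

variable {p : ℝ≥0∞} (M : LpNormedModule p ν V)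

/-- Continuity of the multiplication is not among the module axioms. It follows from the pointwise
norm, since `|f v| = |f| |v|` and `|f| ≤ ‖f‖` a.e. -/
lemma norm_smul_le (f : Lp ℝ ∞ ν) (v : V) : ‖M.smul f v‖ ≤ ‖f‖ * ‖v‖ := by
  rw [M.norm_eq, M.norm_eq v]
  refine Lp.norm_le_mul_norm_of_ae_le_mul ?_
  filter_upwards [M.ptNorm_smul f v, linf_norm_bound f] with x h1 h2
  rw [h1, norm_mul, Real.norm_eq_abs, abs_abs]
  gcongr

/-- Multiplication as a continuous bilinear map. -/
noncomputable def smulL [Fact (1 ≤ p)] : Lp ℝ ∞ ν →L[ℝ] V →L[ℝ] V :=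
  M.smul.mkContinuous₂ 1 fun f v => by simpa using M.norm_smul_le f v

lemma continuous_res [Fact (1 ≤ p)] {A : Set X} (hA : MeasurableSet A) :
    Continuous (M.res hA) :=
  (M.smulL (linfIndicator ν A hA)).continuous

lemma ptNorm_res {A : Set X} (hA : MeasurableSet A) (v : V) :
    M.ptNorm (M.res hA v) =ᵐ[ν] A.indicator (M.ptNorm v) := by
  filter_upwards [M.ptNorm_smul (linfIndicator ν A hA) v, coeFn_linfIndicator hA] with x h1 h2
  rw [LInftyPremodule.res, h1, h2]
  by_cases h : x ∈ A <;> simp [h]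

end

variable (M : LpNormedModule 2 ν V)

lemma enorm_sq_eq_lintegral (v : V) : ‖v‖ₑ ^ 2 = ∫⁻ x, ‖M.ptNorm v x‖ₑ ^ 2 ∂ν := by
  have h : ‖v‖ₑ = ‖M.ptNorm v‖ₑ := by rw [← ofReal_norm, ← ofReal_norm, M.norm_eq]
  rw [h, Lp.enorm_def]
  have := eLpNorm_nnreal_pow_eq_lintegral (f := M.ptNorm v) (μ := ν) (p := 2) two_ne_zero
  simpa using this

/-- As a function of `A` this is a measure, which is where the exponent 2 pays off: countable
additivity becomes Pythagoras' theorem. Values in `[0, ∞]` avoid summability side conditions. -/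
lemma enorm_res_sq_eq_lintegral {A : Set X} (hA : MeasurableSet A) (v : V) :
    ‖M.res hA v‖ₑ ^ 2 = ∫⁻ x in A, ‖M.ptNorm v x‖ₑ ^ 2 ∂ν := by
  rw [M.enorm_sq_eq_lintegral, ← lintegral_indicator hA]
  refine lintegral_congr_ae ?_
  filter_upwards [M.ptNorm_res hA v] with x hx
  rw [hx]
  by_cases h : x ∈ A <;> simp [h]

/-- Pythagoras' theorem for a countable partition. -/
lemma enorm_sq_eq_tsum {ι : Type*} [Countable ι]
    {A : ι → Set X} (hA : ∀ i, MeasurableSet (A i))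
    (hd : Pairwise (Function.onFun Disjoint A)) (hc : ⋃ i, A i = univ) (v : V) :
    ‖v‖ₑ ^ 2 = ∑' i, ‖M.res (hA i) v‖ₑ ^ 2 := by
  simp_rw [M.enorm_res_sq_eq_lintegral]
  rw [← lintegral_iUnion hA hd, hc, Measure.restrict_univ, M.enorm_sq_eq_lintegral]

/-- Pythagoras applied to `v - w`, all of whose pieces vanish. This locality is the source of every
uniqueness statement about values below. -/
lemma eq_of_res_eq {ι : Type*} [Countable ι]
    {A : ι → Set X} (hA : ∀ i, MeasurableSet (A i))
    (hd : Pairwise (Function.onFun Disjoint A)) (hc : ⋃ i, A i = univ)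
    {v w : V} (h : ∀ i, M.res (hA i) v = M.res (hA i) w) : v = w := by
  have h1 := M.enorm_sq_eq_tsum hA hd hc (v - w)
  simp only [map_sub, h, sub_self] at h1
  simpa [sub_eq_zero] using h1

lemma res_sum_res {ι : Type*}
    {A : ι → Set X} (hA : ∀ i, MeasurableSet (A i))
    (hd : Pairwise (Function.onFun Disjoint A))
    (w : ι → V) (s : Finset ι) (i : ι) [Decidable (i ∈ s)] :
    M.res (hA i) (∑ j ∈ s, M.res (hA j) (w j)) = if i ∈ s then M.res (hA i) (w i) else 0 := by
  rw [map_sum]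
  have h : ∀ j, j ≠ i → M.res (hA i) (M.res (hA j) (w j)) = 0 := fun j hj => by
    rw [M.res_res]
    exact M.res_of_eq_empty _ (hd hj.symm).inter_eq _
  split_ifs with hi
  · rw [Finset.sum_eq_single_of_mem i hi fun j _ hj => h j hj, M.res_res_self]
  · exact Finset.sum_eq_zero fun j hj => h j fun hji => hi (hji ▸ hj)

lemma enorm_sum_res_sq {ι : Type*} [Countable ι]
    {A : ι → Set X} (hA : ∀ i, MeasurableSet (A i))
    (hd : Pairwise (Function.onFun Disjoint A)) (hc : ⋃ i, A i = univ)
    (w : ι → V) (s : Finset ι) :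
    ‖∑ i ∈ s, M.res (hA i) (w i)‖ₑ ^ 2 = ∑ i ∈ s, ‖M.res (hA i) (w i)‖ₑ ^ 2 := by
  classical
  simp_rw [M.enorm_sq_eq_tsum hA hd hc (∑ i ∈ s, M.res (hA i) (w i)), M.res_sum_res hA hd]
  rw [tsum_eq_sum (s := s) fun i hi => by simp [hi]]
  exact Finset.sum_congr rfl fun i hi => by rw [if_pos hi]

/-- Gluing along a countable partition. -/
lemma exists_hasSum_res [CompleteSpace V] {ι : Type*} [Countable ι]
    {A : ι → Set X} (hA : ∀ i, MeasurableSet (A i))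
    (hd : Pairwise (Function.onFun Disjoint A)) (hc : ⋃ i, A i = univ)
    {w : ι → V}
    (hw : ∑' i, ‖M.res (hA i) (w i)‖ₑ ^ 2 ≠ ∞) :
    ∃ v, HasSum (fun i => M.res (hA i) (w i)) v ∧ ∀ i, M.res (hA i) v = M.res (hA i) (w i) := by
  classical
  have h1 : Summable fun i => M.res (hA i) (w i) := by
    -- Cauchy criterion: the squared norm of a finite block of the series equals the sum of the
    -- squared norms of its terms, and the latter series converges.
    rw [summable_iff_vanishing_norm]
    intro ε hε
    have h2 : Summable fun i => ‖M.res (hA i) (w i)‖ ^ 2 := by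
      have := ENNReal.summable_toReal hw
      simpa using this
    obtain ⟨s, hs⟩ := summable_iff_vanishing_norm.1 h2 (ε ^ 2) (by positivity)
    refine ⟨s, fun t ht => ?_⟩
    have h3 := hs t ht
    rw [Real.norm_of_nonneg (Finset.sum_nonneg fun i _ => sq_nonneg _)] at h3
    have h4 := congrArg ENNReal.toReal (M.enorm_sum_res_sq hA hd hc w t)
    rw [ENNReal.toReal_sum (fun i _ => by finiteness)] at h4
    simp only [ENNReal.toReal_pow, toReal_enorm] at h4
    rw [← h4] at h3
    exact lt_of_pow_lt_pow_left₀ 2 hε.le h3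
  obtain ⟨v, hv⟩ := h1
  refine ⟨v, hv, fun i => ?_⟩
  -- Multiplying the series by the indicator of `A i` termwise leaves only the `i`-th term, by
  -- disjointness. Comparing the two limits identifies the piece of `v`.
  have h2 := hv.map (M.res (hA i)) (M.continuous_res (hA i))
  refine h2.unique ?_
  have h3 := hasSum_single (f := M.res (hA i) ∘ fun j => M.res (hA j) (w j)) i fun j hj => by
    simpa [hj.symm] using M.res_sum_res hA hd w {j} i
  simpa [M.res_res_self] using h3

/-- Gluing the pieces of `v` gives a limit with the same pieces, which is `v` by locality. This
turns the countable partitions in the definition of the span into limits of finite sums. -/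
lemma hasSum_res [CompleteSpace V] {ι : Type*} [Countable ι]
    {A : ι → Set X} (hA : ∀ i, MeasurableSet (A i))
    (hd : Pairwise (Function.onFun Disjoint A)) (hc : ⋃ i, A i = univ) (v : V) :
    HasSum (fun i => M.res (hA i) v) v := by
  obtain ⟨v', h1, h2⟩ := M.exists_hasSum_res hA hd hc (w := fun _ => v) <| by
    rw [← M.enorm_sq_eq_tsum hA hd hc]
    finiteness
  rwa [M.eq_of_res_eq hA hd hc h2] at h1

end LpNormedModule

end Restriction

/-! ### The carré du champ as density of the energy measure -/

namespace DirichletForm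

variable {X : Type*} [TopologicalSpace X] [MeasurableSpace X] {m : Measure X}
  {E : DirichletForm m} {μ : Measure X}

lemma IsDominant.energy_absolutelyContinuous (hμ : E.IsDominant μ) (f : E.extDomain) :
    E.energy f f ≪ᵥ μ.toENNRealVectorMeasure := by
  refine VectorMeasure.AbsolutelyContinuous.mk fun A hA h0 => ?_
  rw [Measure.toENNRealVectorMeasure_apply_measurable hA] at h0
  have h := hμ.energyMeasure_absolutelyContinuous f h0
  rw [E.energyMeasure_apply f hA, ENNReal.ofReal_eq_zero] at h
  exact le_antisymm h (E.energy_nonneg f A)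

lemma integrable_carreDuChamp (f : E.extDomain) : Integrable (E.carreDuChamp μ f f) μ :=
  SignedMeasure.integrable_rnDeriv _ _

/-- Radon–Nikodym: absolute continuity leaves no singular part, so integrating the density recovers
the whole energy measure. -/
lemma IsDominant.setIntegral_carreDuChamp (hμ : E.IsDominant μ) (f : E.extDomain) {A : Set X}
    (hA : MeasurableSet A) : ∫ x in A, E.carreDuChamp μ f f x ∂μ = E.energy f f A := by
  have := hμ.sigmaFinite
  have h := SignedMeasure.withDensityᵥ_rnDeriv_eq _ _ (hμ.energy_absolutelyContinuous f)
  conv_rhs => rw [← h]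
  rw [withDensityᵥ_apply (SignedMeasure.integrable_rnDeriv _ _) hA]
  rfl

lemma IsDominant.carreDuChamp_nonneg (hμ : E.IsDominant μ) (f : E.extDomain) :
    0 ≤ᵐ[μ] E.carreDuChamp μ f f :=
  ae_nonneg_of_forall_setIntegral_nonneg (integrable_carreDuChamp f) fun A hA _ => by
    rw [hμ.setIntegral_carreDuChamp f hA]
    exact E.energy_nonneg f A

lemma IsDominant.setLIntegral_carreDuChamp (hμ : E.IsDominant μ) (f : E.extDomain) {A : Set X}
    (hA : MeasurableSet A) :
    ∫⁻ x in A, ENNReal.ofReal (E.carreDuChamp μ f f x) ∂μ = E.energyMeasure f A := by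
  rw [E.energyMeasure_apply f hA, ← hμ.setIntegral_carreDuChamp f hA,
    ofReal_integral_eq_lintegral_ofReal (integrable_carreDuChamp f).integrableOn
      (ae_restrict_of_ae (hμ.carreDuChamp_nonneg f))]

/-! ### Values of the induced morphism on step functions -/

variable {V : Type*} [NormedAddCommGroup V] [NormedSpace ℝ V]
  (M : LpNormedModule 2 μ V) (δ : E.extDomain →ₗ[ℝ] V)

/-- The pointwise norm of `δ f` is `Γ_μ(f)^{1/2}`. -/
def HasCarreDuChampNorm : Prop :=
  ∀ f : E.extDomain, ∀ᵐ x ∂μ, M.ptNorm (δ f) x = √(E.carreDuChamp μ f f x)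

/-- `v` is the value on `F` of the module morphism induced by `δ`: it coincides with `δ h`
wherever `F` is equal to `h`. -/
def IsValue (F : X → E.extDomain) (v : V) : Prop :=
  ∀ (A : Set X) (hA : MeasurableSet A) (h : E.extDomain), (∀ x ∈ A, F x = h) →
    M.res hA v = M.res hA (δ h)

variable {M δ}

/-- The only point where the pointwise norm of `δ f` is evaluated. It matches the norm of `V` with
the seminorm of the pre-cotangent module piece by piece. -/
lemma HasCarreDuChampNorm.enorm_res_sq (hδ : HasCarreDuChampNorm M δ) (hμ : E.IsDominant μ)
    (f : E.extDomain) {A : Set X} (hA : MeasurableSet A) :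
    ‖M.res hA (δ f)‖ₑ ^ 2 = E.energyMeasure f A := by
  rw [M.enorm_res_sq_eq_lintegral, ← hμ.setLIntegral_carreDuChamp f hA]
  refine lintegral_congr_ae (ae_restrict_of_ae ?_)
  filter_upwards [hδ f, hμ.carreDuChamp_nonneg f] with x h1 h2
  rw [h1, Real.enorm_of_nonneg (Real.sqrt_nonneg _), ← ENNReal.ofReal_pow (Real.sqrt_nonneg _),
    Real.sq_sqrt h2]

section Rep

variable {ι : Type*} [Countable ι] {F : X → E.extDomain} {f : ι → E.extDomain} {A : ι → Set X}

-- One representation suffices to test a value: where another set `B` with constant value `k` meets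
-- `A i`, any common point forces `k = f i`, and locality assembles the pieces of `B`.
omit [TopologicalSpace X] in
lemma IsRep.isValue (hF : E.IsRep F f A) {v : V}
    (h : ∀ i, M.res (hF.meas i) v = M.res (hF.meas i) (δ (f i))) : IsValue M δ F v := by
  intro B hB k hk
  refine M.eq_of_res_eq hF.meas hF.disj hF.cover fun i => ?_
  rw [M.res_res, M.res_res]
  -- On an empty intersection `k` and `f i` are unrelated, but both sides are then zero.
  rcases (A i ∩ B).eq_empty_or_nonempty with h0 | ⟨x, hx⟩
  · rw [M.res_of_eq_empty _ h0, M.res_of_eq_empty _ h0]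
  · rw [← hk x hx.2, hF.eq i x hx.1]
    exact M.res_inter_congr (hF.meas i) hB (h i)

/-- The pieces `1_{A i} δ (f i)` have squared norms adding up to the energy of `F`, so they can be
glued. -/
lemma IsRep.exists_isValue [CompleteSpace V] (hδ : HasCarreDuChampNorm M δ)
    (hμ : E.IsDominant μ) (hF : E.IsRep F f A) (hfin : E.stepEnergy F ≠ ∞) :
    ∃ v, IsValue M δ F v := by
  obtain ⟨v, -, hv⟩ := M.exists_hasSum_res hF.meas hF.disj hF.cover (w := fun i => δ (f i)) <| by
    simp_rw [hδ.enorm_res_sq hμ]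
    rwa [← hF.stepEnergy_eq]
  exact ⟨v, hF.isValue hv⟩

omit [TopologicalSpace X] in
lemma IsRep.eq_of_isValue (hF : E.IsRep F f A) {v w : V} (hv : IsValue M δ F v)
    (hw : IsValue M δ F w) : v = w :=
  M.eq_of_res_eq hF.meas hF.disj hF.cover fun i =>
    (hv _ (hF.meas i) _ (hF.eq i)).trans (hw _ (hF.meas i) _ (hF.eq i)).symm

lemma IsRep.enorm_sq_of_isValue (hδ : HasCarreDuChampNorm M δ) (hμ : E.IsDominant μ)
    (hF : E.IsRep F f A) {v : V} (hv : IsValue M δ F v) : ‖v‖ₑ ^ 2 = E.stepEnergy F := by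
  rw [M.enorm_sq_eq_tsum hF.meas hF.disj hF.cover, hF.stepEnergy_eq]
  refine tsum_congr fun i => ?_
  rw [hv _ (hF.meas i) _ (hF.eq i), hδ.enorm_res_sq hμ]

/-- On the common refinement of the two partitions this reduces to additivity of `δ`. -/
lemma IsRep.isValue_add {κ : Type*} [Countable κ] {G : X → E.extDomain} {g : κ → E.extDomain}
    {B : κ → Set X} (hF : E.IsRep F f A) (hG : E.IsRep G g B) {v w : V}
    (hv : IsValue M δ F v) (hw : IsValue M δ G w) : IsValue M δ (F + G) (v + w) := by
  obtain ⟨h1, h2, h3⟩ := hF.inter hG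
  refine h3.isValue fun p => ?_
  rw [map_add, map_add, map_add, hv _ _ _ (h1.eq p), hw _ _ _ (h2.eq p)]

lemma IsRep.isValue_simple (hF : E.IsRep F f A) (s : SimpleFunc X ℝ) {v : V}
    (hv : IsValue M δ F v) : IsValue M δ (fun x => s x • F x) (M.smul (linfSimple μ s) v) := by
  refine (hF.simple s).isValue fun p => ?_
  have hs : ∀ u, M.res ((hF.simple s).meas p) (M.smul (linfSimple μ s) u) =
      (p.2 : ℝ) • M.res ((hF.simple s).meas p) u := fun u => by
    -- On a fibre of `s`, multiplication by `s` is multiplication by a real scalar, and `δ` is only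
    -- known to commute with those.
    have h0 : (linfIndicator μ _ ((hF.simple s).meas p) • linfSimple μ s : Lp ℝ ∞ μ) =
        (p.2 : ℝ) • linfIndicator μ _ ((hF.simple s).meas p) := by
      rw [linfIndicator, linfSimple_mul, ← map_smul]
      congr 1
      ext x
      by_cases h : x ∈ A p.1 ∩ s ⁻¹' {(p.2 : ℝ)}
      · simp [h, show s x = p.2 from h.2]
      · simp [h]
    rw [LInftyPremodule.res, ← M.mul_smul, h0, map_smul, LinearMap.smul_apply]
  rw [hs, hv _ ((hF.simple s).meas p) _ fun x hx => hF.eq _ x hx.1, map_smul, map_smul]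

end Rep

lemma isValue_smul {F : X → E.extDomain} {v : V} (hv : IsValue M δ F v) (hF : F ∈ E.preCotangent)
    (c : ℝ) : IsValue M δ (c • F) (c • v) := by
  obtain ⟨f, A, hF, -⟩ := hF
  refine (hF.smul c).isValue fun i => ?_
  rw [map_smul, map_smul, map_smul, hv _ _ _ (hF.eq i)]

lemma eq_of_isValue {F : E.PreCotangent} {v w : V} (hv : IsValue M δ F.toFun v)
    (hw : IsValue M δ F.toFun w) : v = w := by
  obtain ⟨f, A, hF, -⟩ := F.2
  exact hF.eq_of_isValue hv hw

/-! ### Extension to the cotangent module, bijectivity and uniqueness -/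

section Lift

variable [CompleteSpace V]

lemma HasCarreDuChampNorm.exists_isValue (hδ : HasCarreDuChampNorm M δ)
    (hμ : E.IsDominant μ) (F : E.PreCotangent) : ∃ v, IsValue M δ F.toFun v := by
  obtain ⟨f, A, hF, -⟩ := F.2
  exact hF.exists_isValue hδ hμ F.stepEnergy_ne_top

/-- The isometry of the pre-cotangent module into `V` induced by `δ`. -/
noncomputable def HasCarreDuChampNorm.preLift (hδ : HasCarreDuChampNorm M δ)
    (hμ : E.IsDominant μ) : E.PreCotangent →ₗᵢ[ℝ] V where
  toFun F := (hδ.exists_isValue hμ F).choose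
  -- The value is picked by choice, yet depends linearly on `F` because values are unique: the sum
  -- of the chosen values is a value of the sum.
  map_add' F G := by
    obtain ⟨f, A, hF, -⟩ := F.2
    obtain ⟨g, B, hG, -⟩ := G.2
    exact eq_of_isValue (hδ.exists_isValue hμ (F + G)).choose_spec <| hF.isValue_add hG
      (hδ.exists_isValue hμ F).choose_spec (hδ.exists_isValue hμ G).choose_spec
  map_smul' c F := eq_of_isValue (hδ.exists_isValue hμ (c • F)).choose_spec <|
    isValue_smul (hδ.exists_isValue hμ F).choose_spec F.2 c
  norm_map' F := by
    obtain ⟨f, A, hF, -⟩ := F.2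
    have h := congrArg ENNReal.toReal <|
      hF.enorm_sq_of_isValue hδ hμ (hδ.exists_isValue hμ F).choose_spec
    rw [ENNReal.toReal_pow, toReal_enorm] at h
    exact (pow_left_inj₀ (norm_nonneg _) (norm_nonneg _) two_ne_zero).1
      (h.trans (PreCotangent.norm_sq F).symm)

variable (hδ : HasCarreDuChampNorm M δ) (hμ : E.IsDominant μ)

lemma HasCarreDuChampNorm.isValue_preLift (F : E.PreCotangent) :
    IsValue M δ F.toFun (hδ.preLift hμ F) :=
  (hδ.exists_isValue hμ F).choose_spec

lemma HasCarreDuChampNorm.preLift_eq {F : E.PreCotangent} {v : V}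
    (hv : IsValue M δ F.toFun v) : hδ.preLift hμ F = v :=
  eq_of_isValue (hδ.isValue_preLift hμ F) hv

/-- The isometry of the cotangent module into `V` induced by `δ`. -/
noncomputable def HasCarreDuChampNorm.lift : E.Cotangent →ₗᵢ[ℝ] V where
  toLinearMap := ((hδ.preLift hμ).toLinearMap.extendOfNorm
    (UniformSpace.Completion.toComplL (𝕜 := ℝ) (E := E.PreCotangent)).toLinearMap).toLinearMap
  norm_map' ω := by
    have hd : DenseRange (UniformSpace.Completion.toComplL (𝕜 := ℝ)
      (E := E.PreCotangent)).toLinearMap := UniformSpace.Completion.denseRange_coe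
    refine hd.induction_on (p := fun ω => ‖((hδ.preLift hμ).toLinearMap.extendOfNorm
      (UniformSpace.Completion.toComplL (𝕜 := ℝ) (E := E.PreCotangent)).toLinearMap) ω‖ = ‖ω‖) ω
      (isClosed_eq (by fun_prop) (by fun_prop)) fun F => ?_
    rw [LinearMap.extendOfNorm_eq hd ⟨1, fun F => by simp⟩]
    simp

lemma HasCarreDuChampNorm.lift_coe (F : E.PreCotangent) :
    hδ.lift hμ (F : E.Cotangent) = hδ.preLift hμ F :=
  LinearMap.extendOfNorm_eq (e := (UniformSpace.Completion.toComplL (𝕜 := ℝ)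
    (E := E.PreCotangent)).toLinearMap) UniformSpace.Completion.denseRange_coe
    ⟨1, fun F => by simp⟩ F

lemma HasCarreDuChampNorm.lift_d (f : E.extDomain) : hδ.lift hμ (E.d f) = δ f := by
  refine (hδ.lift_coe hμ (E.preD f)).trans (hδ.preLift_eq hμ ?_)
  exact (isRep_const f).isValue fun _ => rfl

/-- Both sides are jointly continuous in the function and the form, so simple functions acting on
the pre-cotangent module suffice. There the action is pointwise and compatible with values. -/
lemma HasCarreDuChampNorm.lift_smul (f : Lp ℝ ∞ μ) (ω : E.Cotangent) :
    hδ.lift hμ ((E.cotangentModule hμ).smul f ω) = M.smul f (hδ.lift hμ ω) := by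
  change hδ.lift hμ (linfAct hμ f ω) = M.smulL f (hδ.lift hμ ω)
  have hd := (denseRange_linfSimple μ).prodMap
    (UniformSpace.Completion.denseRange_coe (α := E.PreCotangent))
  refine hd.induction_on (p := fun q : Lp ℝ ∞ μ × E.Cotangent =>
    hδ.lift hμ (linfAct hμ q.1 q.2) = M.smulL q.1 (hδ.lift hμ q.2)) (f, ω) ?_ ?_
  · refine isClosed_eq ((hδ.lift hμ).continuous.comp ?_) ?_
    · fun_prop
    · have := (hδ.lift hμ).continuous
      fun_prop
  · rintro ⟨s, F⟩
    simp only [Prod.map_apply, linfAct_simple, simpleAct_coe, lift_coe]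
    refine hδ.preLift_eq hμ ?_
    obtain ⟨f, A, hF, -⟩ := F.2
    exact hF.isValue_simple s (hδ.isValue_preLift hμ F)

/-- The range is closed, as the isometric image of a complete space, so by generation it only has to
contain the span of the vectors `δ f`. -/
lemma HasCarreDuChampNorm.lift_surjective (hgen : M.IsGeneratedBy (range δ)) :
    Function.Surjective (hδ.lift hμ) := by
  have hcl : IsClosed (range (hδ.lift hμ)) :=
    (hδ.lift hμ).isometry.isClosedEmbedding.isClosed_range
  refine range_eq_univ.1 (univ_subset_iff.1 ?_)
  rw [← hgen]
  refine closure_minimal ?_ hcl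
  rintro v ⟨A, hA, hd, hc, h⟩
  -- `v` is the limit of finite sums of the pieces `1_{A k} v`, each of which is an
  -- `L^∞`-combination of vectors `δ g = lift (d g)` and so lies in the range.
  refine hcl.mem_of_tendsto (M.hasSum_res hA hd hc v) (Eventually.of_forall fun s => ?_)
  refine Submodule.sum_mem (LinearMap.range (hδ.lift hμ).toLinearMap) fun k _ => ?_
  obtain ⟨n, f, w, hw, h⟩ := h k
  rw [LInftyPremodule.res, h]
  refine Submodule.sum_mem _ fun i _ => ?_
  obtain ⟨g, hg⟩ := hw i
  exact ⟨(E.cotangentModule hμ).smul (f i) (E.d g),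
    (hδ.lift_smul hμ _ _).trans (by rw [lift_d, hg])⟩

lemma HasCarreDuChampNorm.isIsomorphism_lift (hgen : M.IsGeneratedBy (range δ)) :
    (E.cotangentModule hμ).IsIsomorphism M.toLInftyPremodule
      (hδ.lift hμ).toContinuousLinearMap := by
  let e := LinearIsometryEquiv.ofSurjective (hδ.lift hμ) (hδ.lift_surjective hμ hgen)
  have he : ∀ ω, e ω = hδ.lift hμ ω := fun _ => rfl
  refine ⟨hδ.lift_smul hμ, (e.symm.toContinuousLinearEquiv : V →L[ℝ] E.Cotangent),
    fun f v => ?_, ?_, ?_⟩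
  · change e.symm (M.smul f v) = (E.cotangentModule hμ).smul f (e.symm v)
    rw [e.symm_apply_eq, he, hδ.lift_smul hμ, ← he, e.apply_symm_apply]
  · ext v
    exact e.apply_symm_apply v
  · ext ω
    exact e.symm_apply_apply ω

/-- By `L^∞`-linearity, `Φ F` is itself a value on `F`, so uniqueness of values applies on a dense
subspace. Invertibility of `Φ` plays no role. -/
lemma HasCarreDuChampNorm.eq_lift {Φ : E.Cotangent →L[ℝ] V}
    (hΦ : (E.cotangentModule hμ).IsMorphism M.toLInftyPremodule Φ)
    (hd : ∀ f, Φ (E.d f) = δ f) : Φ = (hδ.lift hμ).toContinuousLinearMap := by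
  ext ω
  change Φ ω = hδ.lift hμ ω
  induction ω using UniformSpace.Completion.induction_on with
  | hp => exact isClosed_eq Φ.continuous (hδ.lift hμ).continuous
  | ih F =>
    rw [lift_coe]
    refine (hδ.preLift_eq hμ fun A hA h hF => ?_).symm
    -- This equality holds already before completion: cut off to `A`, the function `F` and the
    -- constant `h` are the same function.
    have key : (E.cotangentModule hμ).res hA F = (E.cotangentModule hμ).res hA (E.d h) := by
      change linfAct hμ (linfIndicator μ A hA) F = linfAct hμ (linfIndicator μ A hA) (E.preD h)
      rw [linfIndicator, linfAct_simple, simpleAct_coe, simpleAct_coe]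
      refine congrArg _ (Subtype.ext (funext fun x => ?_))
      change _ • F.toFun x = _ • h
      by_cases hx : x ∈ A
      · rw [hF x hx]
      · simp [hx]
    calc M.res hA (Φ F) = Φ ((E.cotangentModule hμ).res hA F) := (hΦ _ _).symm
      _ = M.res hA (δ h) := by rw [key, ← hd]; exact hΦ _ _

end Lift

end DirichletForm

theorem mainTheorem4 {X : Type*} [TopologicalSpace X] [LusinSpace X] [MeasurableSpace X]
    [BorelSpace X] (m : Measure X) [SigmaFinite m] [m.IsOpenPosMeasure]
    (E : DirichletForm m) (hqr : E.IsQuasiRegular) (hsl : E.IsStronglyLocal)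
    (μ : Measure X) (hμ : E.IsDominant μ)
    {V : Type*} [NormedAddCommGroup V] [NormedSpace ℝ V] [CompleteSpace V]
    (M : LpNormedModule 2 μ V) (δ : E.extDomain →ₗ[ℝ] V)
    (hgen : M.IsGeneratedBy (Set.range δ))
    (hnorm : ∀ f : E.extDomain, ∀ᵐ x ∂μ, M.ptNorm (δ f) x = √(E.carreDuChamp μ f f x)) :
    ∃! Φ : E.Cotangent →L[ℝ] V,
      (E.cotangentModule hμ).IsIsomorphism M.toLInftyPremodule Φ ∧ ∀ f, Φ (E.d f) = δ f := by
  have hδ : DirichletForm.HasCarreDuChampNorm M δ := hnorm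
  exact ⟨(hδ.lift hμ).toContinuousLinearMap,
    ⟨hδ.isIsomorphism_lift hμ hgen, hδ.lift_d hμ⟩, fun Φ hΦ => hδ.eq_lift hμ hΦ.1.1 hΦ.2⟩
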